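/- Let $n > k \geq 1$ be integers, and let $K_{n,k}$ be the simplicial complex whose vertices are the surjective maps $[n]\to[k]$, where a set $\{\varphi_1,\dots,\varphi_r\}$ of surjections is a face if and only if $\varphi_1^{-1}(i)\cap\cdots\cap\varphi_r^{-1}(i)\neq\emptyset$ for every $i\in[k]$. Then $K_{n,k}$ is $(n-k-1)$-connected: for every integer $-1\le i\le n-k-1$, every continuous map from the sphere $S^{i}$ to the geometric realization of $K_{n,k}$ extends to a continuous map from the ball $B^{i+1}$ (where $S^{-1}=\emptyset$, so that the case $i=-1$ says that $K_{n,k}$ is nonempty). -/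

import Mathlib

/-- The set `V_{n,k}` of surjective maps `[n] → [k]`. -/
abbrev SurjVertex (n k : ℕ) : Type :=
  {φ : Fin n → Fin k // Function.Surjective φ}

/-- The simplicial complex `K_{n,k}` on the vertex set `V_{n,k}`: a nonempty set `σ` of surjections
is a face iff, for each `i`, the preimages `φ⁻¹(i)`, `φ ∈ σ`, have a common element.
(As usual in Mathlib, the empty face is not listed.) -/
def surjComplex (n k : ℕ) : AbstractSimplicialComplex (SurjVertex n k) where
  faces := {σ | σ.Nonempty ∧ ∀ i : Fin k, (⋂ φ ∈ σ, φ.1 ⁻¹' {i}).Nonempty}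
  isRelLowerSet_faces := by
    rintro σ ⟨hne, hσ⟩
    refine ⟨hne, fun τ hτ hτne => ⟨hτne, fun i => (hσ i).mono ?_⟩⟩
    exact Set.biInter_subset_biInter_left hτ
  singleton_mem := by
    intro φ
    refine ⟨Finset.singleton_nonempty φ, fun i => ?_⟩
    obtain ⟨j, hj⟩ := φ.2 i
    exact ⟨j, by simpa using hj⟩

/-- The geometric realization of an abstract simplicial complex on a finite vertex set `V`, as a
subspace of `ℝ^V` (with its usual topology): the union, over the faces `σ`, of the simplices
spanned by the standard basis vectors `e_v`, `v ∈ σ`. -/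
def AbstractSimplicialComplex.realization {V : Type*} [Fintype V]
    (K : AbstractSimplicialComplex V) : Set (V → ℝ) :=
  {x | x ∈ stdSimplex ℝ V ∧ ∃ σ ∈ K.faces, ∀ v, v ∉ σ → x v = 0}

/-- A space `X` is `m`-connected if, for each `i` with `-1 ≤ i ≤ m`, every continuous map from
the sphere `S^i` to `X` extends to a continuous map from the ball `B^{i+1}` to `X`.
Here `d = i + 1`; the case `d = 0` (`S^{-1} = ∅`, `B^0` a point) says that `X` is nonempty. -/
def IsMConnected (m : ℤ) (X : Type*) [TopologicalSpace X] : Prop :=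
  ∀ d : ℕ, (d : ℤ) ≤ m + 1 →
    ∀ f : C(Metric.sphere (0 : EuclideanSpace ℝ (Fin d)) 1, X),
      ∃ F : C(Metric.closedBall (0 : EuclideanSpace ℝ (Fin d)) 1, X),
        ∀ x : Metric.sphere (0 : EuclideanSpace ℝ (Fin d)) 1,
          F ⟨x.1, Metric.sphere_subset_closedBall x.2⟩ = f x

/-! The surjections are replaced by all maps `[n] → [k]`, with only the values in a subset `S`
required to be attained at common points (`coverFaces`). This generality is forced by the induction:
deleting a point of `[n]` can destroy surjectivity. The claim becomes that maps from `S^{d-1}`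
extend over `B^d` whenever `d + |S| ≤ n` (`sphereExtends_coverFaces`); for `S` everything, the
simplices consist of surjections and the complex is `K_{n,k}`.

The induction is on `n`. For `S = ∅` the complex is a full simplex. Otherwise the point `0` is split
off: a simplex either covers `S` without `0` (`coverOffZero`), or needs `0` for exactly one value `j
∈ S`. Hence the complex is the union over `j ∈ S` of the pieces `coverZeroAt`, any two of which meet
in `coverOffZero`. Forgetting the value at `0` reduces the `j`-th piece to `(n, S \ {j})` and the
common part to `(n, S)`, so the pieces are as connected as required and the common part at most one
step less.

`SphereExtends.iUnion` glues such pieces without homology. A map from `S^{d-1}` is approximated by a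
simplicial map on a complex `L` of dimension less than `d`; this map is extended over the cone on
`L` one simplex at a time, each simplex being assigned a piece or the common part in which its image
must stay. -/

/-! ### Extension of maps from spheres; homotopy and contiguity. -/

section SphereExtension

open Set Metric

/-- Every map from the unit sphere of `ℝ^d` (with the sup norm) to `A` extends to the unit ball. -/
def SphereExtends {E : Type*} [TopologicalSpace E] (d : ℕ) (A : Set E) : Prop :=
  ∀ f : (Fin d → ℝ) → E, ContinuousOn f (sphere 0 1) → MapsTo f (sphere 0 1) A →
    ∃ F : (Fin d → ℝ) → E, ContinuousOn F (closedBall 0 1) ∧ MapsTo F (closedBall 0 1) A ∧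
      EqOn F f (sphere 0 1)

/-- A map on the sphere that is homotopic to one extending to the ball extends to the ball. -/
theorem exists_extension_of_homotopy {E : Type*} [TopologicalSpace E] {d : ℕ} {A : Set E}
    {G : (Fin d → ℝ) → E} (hG : ContinuousOn G (closedBall 0 1))
    (hGA : MapsTo G (closedBall 0 1) A) {H : ℝ × (Fin d → ℝ) → E}
    (hH : ContinuousOn H (Icc 0 1 ×ˢ sphere 0 1)) (hHA : MapsTo H (Icc 0 1 ×ˢ sphere 0 1) A)
    (h0 : ∀ x ∈ sphere (0 : Fin d → ℝ) 1, H (0, x) = G x) :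
    ∃ F : (Fin d → ℝ) → E, ContinuousOn F (closedBall 0 1) ∧ MapsTo F (closedBall 0 1) A ∧
      ∀ x ∈ sphere (0 : Fin d → ℝ) 1, F x = H (1, x) := by
  classical
  -- `G` is shrunk to the ball of radius `1/2`, and the homotopy fills the collar outside it.
  let F : (Fin d → ℝ) → E := fun x =>
    if ‖x‖ ≤ 1 / 2 then G ((2 : ℝ) • x) else H (2 * ‖x‖ - 1, ‖x‖⁻¹ • x)
  have hin : MapsTo (fun x : Fin d → ℝ => (2 : ℝ) • x) (closedBall 0 (1 / 2)) (closedBall 0 1) := by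
    intro x hx
    simp only [mem_closedBall, dist_zero_right, norm_smul, Real.norm_ofNat] at hx ⊢
    linarith
  have hout : MapsTo (fun x : Fin d → ℝ => (2 * ‖x‖ - 1, ‖x‖⁻¹ • x))
      {x | 1 / 2 ≤ ‖x‖ ∧ ‖x‖ ≤ 1} (Icc 0 1 ×ˢ sphere 0 1) := by
    rintro x ⟨h1, h2⟩
    refine ⟨⟨by dsimp only; linarith, by dsimp only; linarith⟩, ?_⟩
    have : ‖x‖ ≠ 0 := by linarith
    simp [norm_smul, this]
  have hFin : EqOn F (fun x => G ((2 : ℝ) • x)) (closedBall 0 (1 / 2)) := by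
    intro x hx
    simp only [mem_closedBall, dist_zero_right] at hx
    simp only [F, if_pos hx]
  have hFout : EqOn F (fun x => H (2 * ‖x‖ - 1, ‖x‖⁻¹ • x)) {x | 1 / 2 ≤ ‖x‖ ∧ ‖x‖ ≤ 1} := by
    rintro x ⟨h1, h2⟩
    rcases h1.lt_or_eq with h | h
    · simp only [F, if_neg (not_le.2 h)]
    · have hx : ‖x‖⁻¹ • x = (2 : ℝ) • x := by rw [← h]; norm_num
      have hm := (hout ⟨h1, h2⟩).2
      dsimp only at hm
      simp only [F, if_pos h.symm.le]
      rw [hx] at hm ⊢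
      rw [← h0 _ hm, ← h]
      norm_num
  have hunion : closedBall (0 : Fin d → ℝ) 1 =
      closedBall 0 (1 / 2) ∪ {x | 1 / 2 ≤ ‖x‖ ∧ ‖x‖ ≤ 1} := by
    ext x
    simp only [mem_closedBall, dist_zero_right, mem_union, mem_ofPred_eq]
    constructor
    · intro h
      rcases le_total ‖x‖ (1 / 2) with h' | h'
      · exact Or.inl h'
      · exact Or.inr ⟨h', h⟩
    · rintro (h | h) <;> linarith
  refine ⟨F, ?_, ?_, ?_⟩
  · rw [hunion]
    refine ContinuousOn.union_of_isClosed ?_ ?_ isClosed_closedBall ?_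
    · exact (hG.comp (by fun_prop) hin).congr hFin
    · refine (hH.comp ?_ hout).congr hFout
      refine ((continuousOn_const.mul continuousOn_id.norm).sub continuousOn_const).prodMk
        ((continuousOn_id.norm.inv₀ ?_).smul continuousOn_id)
      rintro x ⟨h1, -⟩ h
      rw [id] at h
      rw [h] at h1
      norm_num at h1
    · exact (isClosed_le continuous_const continuous_norm).inter
        (isClosed_le continuous_norm continuous_const)
  · rw [hunion]
    rintro x (hx | hx)
    · rw [hFin hx]
      exact hGA (hin hx)
    · rw [hFout hx]
      exact hHA (hout hx)
  · intro x hx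
    have hx' : ‖x‖ = 1 := by simpa using hx
    rw [hFout ⟨by rw [hx']; norm_num, hx'.le⟩]
    dsimp only
    rw [hx']
    norm_num

theorem Convex.sphereExtends {E : Type*} [AddCommGroup E] [Module ℝ E] [TopologicalSpace E]
    [ContinuousAdd E] [ContinuousSMul ℝ E] {A : Set E} (hA : Convex ℝ A) (hne : A.Nonempty)
    (d : ℕ) : SphereExtends d A := by
  obtain ⟨c, hc⟩ := hne
  intro f hf hfA
  obtain ⟨F, h1, h2, h3⟩ := exists_extension_of_homotopy (d := d) (A := A) (G := fun _ => c)
    (H := fun p => (1 - p.1) • c + p.1 • f p.2) continuousOn_const (fun _ _ => hc)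
    (by
      have : ContinuousOn (fun p : ℝ × (Fin d → ℝ) => f p.2) (Icc 0 1 ×ˢ sphere 0 1) :=
        hf.comp continuousOn_snd fun p hp => hp.2
      exact ((continuousOn_const.sub continuousOn_fst).smul continuousOn_const).add
        (continuousOn_fst.smul this))
    (fun p hp => hA hc (hfA hp.2) (by linarith [hp.1.2]) hp.1.1 (by ring))
    (by simp)
  exact ⟨F, h1, h2, fun x hx => by simpa using h3 x hx⟩

/-- The set of vertices with nonzero coordinate. -/
noncomputable def coordSupport {V : Type*} [Fintype V] (x : V → ℝ) : Finset V :=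
  open scoped Classical in Finset.univ.filter fun v => x v ≠ 0

@[simp] theorem mem_coordSupport {V : Type*} [Fintype V] {x : V → ℝ} {v : V} :
    v ∈ coordSupport x ↔ x v ≠ 0 := by
  simp [coordSupport]

/-- The points of the standard simplex whose support belongs to `K`. -/
def polyhedron {V : Type*} [Fintype V] (K : Set (Finset V)) : Set (V → ℝ) :=
  {x | x ∈ stdSimplex ℝ V ∧ coordSupport x ∈ K}

theorem polyhedron_mono {V : Type*} [Fintype V] {K L : Set (Finset V)} (h : K ⊆ L) :
    polyhedron K ⊆ polyhedron L := fun _ hx => ⟨hx.1, h hx.2⟩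

theorem coordSupport_nonempty {V : Type*} [Fintype V] {x : V → ℝ} (hx : x ∈ stdSimplex ℝ V) :
    (coordSupport x).Nonempty := by
  by_contra h
  rw [Finset.not_nonempty_iff_eq_empty] at h
  have h0 : ∀ v, x v = 0 := fun v => by
    by_contra hv
    simpa [h] using mem_coordSupport.2 hv
  simpa [h0] using hx.2

/-- A finite union of closed simplices. Closedness allows continuous maps on subcomplexes to be
pasted. -/
theorem isClosed_polyhedron {V : Type*} [Fintype V] {K : Set (Finset V)} (hK : IsLowerSet K) :
    IsClosed (polyhedron K) := by
  have : polyhedron K =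
      ⋃ σ ∈ K, stdSimplex ℝ V ∩ ⋂ v : V, {x | v ∉ σ → x v = 0} := by
    ext x
    simp only [polyhedron, mem_ofPred_eq, mem_iUnion, mem_inter_iff, mem_iInter, exists_prop]
    constructor
    · rintro ⟨h1, h2⟩
      exact ⟨_, h2, h1, fun v hv => by simpa using hv⟩
    · rintro ⟨σ, hσ, h1, h2⟩
      exact ⟨h1, hK (fun v hv => by_contra fun h => mem_coordSupport.1 hv (h2 v h)) hσ⟩
  rw [this]
  refine (Set.toFinite K).isClosed_biUnion fun σ _ => ?_
  refine (isClosed_stdSimplex ℝ V).inter (isClosed_iInter fun v => ?_)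
  by_cases h : v ∈ σ
  · simp [h]
  · simpa [h] using isClosed_eq (continuous_apply v) continuous_const

/-- Maps into a polyhedron that are pointwise in common faces: if one extends, so does the other. -/
theorem exists_extension_of_contiguous {V : Type*} [Fintype V] {K : Set (Finset V)}
    (hK : IsLowerSet K) {d : ℕ} {G f : (Fin d → ℝ) → V → ℝ}
    (hG : ContinuousOn G (closedBall 0 1)) (hGK : MapsTo G (closedBall 0 1) (polyhedron K))
    (hf : ContinuousOn f (sphere 0 1)) (hfK : MapsTo f (sphere 0 1) (polyhedron K))
    (hc : ∀ x ∈ sphere (0 : Fin d → ℝ) 1, ∃ σ ∈ K, coordSupport (G x) ⊆ σ ∧ coordSupport (f x) ⊆ σ) :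
    ∃ F : (Fin d → ℝ) → V → ℝ, ContinuousOn F (closedBall 0 1) ∧
      MapsTo F (closedBall 0 1) (polyhedron K) ∧ EqOn F f (sphere 0 1) := by
  obtain ⟨F, h1, h2, h3⟩ := exists_extension_of_homotopy hG hGK
    -- The straight-line homotopy stays inside the common simplex `σ`.
    (H := fun p => (1 - p.1) • G p.2 + p.1 • f p.2)
    (by
      have h1 : ContinuousOn (fun p : ℝ × (Fin d → ℝ) => f p.2) (Icc 0 1 ×ˢ sphere 0 1) :=
        hf.comp continuousOn_snd fun p hp => hp.2
      have h2 : ContinuousOn (fun p : ℝ × (Fin d → ℝ) => G p.2) (Icc 0 1 ×ˢ sphere 0 1) :=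
        hG.comp continuousOn_snd fun p hp => sphere_subset_closedBall hp.2
      exact ((continuousOn_const.sub continuousOn_fst).smul h2).add (continuousOn_fst.smul h1))
    (by
      rintro ⟨t, x⟩ ⟨ht, hx⟩
      dsimp only at ht hx
      refine ⟨convex_stdSimplex ℝ V (hGK (sphere_subset_closedBall hx)).1 (hfK hx).1
        (by linarith [ht.2]) ht.1 (by ring), ?_⟩
      obtain ⟨σ, hσ, hg, hf⟩ := hc x hx
      refine hK (fun v hv => ?_) hσ
      by_contra hvσ
      have e1 : G x v = 0 := by_contra fun h => hvσ (hg (mem_coordSupport.2 h))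
      have e2 : f x v = 0 := by_contra fun h => hvσ (hf (mem_coordSupport.2 h))
      simp [e1, e2] at hv)
    (by simp)
  exact ⟨F, h1, h2, fun x hx => by simpa using h3 x hx⟩

/-- The linear map induced by a map of vertices. -/
noncomputable def vertexPush {I V : Type*} [Fintype I] (g : I → V) (x : I → ℝ) : V → ℝ :=
  open scoped Classical in fun v => ∑ i, if g i = v then x i else 0

theorem continuous_vertexPush {I V : Type*} [Fintype I] (g : I → V) :
    Continuous (vertexPush g) := by
  classical
  unfold vertexPush
  refine continuous_pi fun v => continuous_finsetSum _ fun i _ => ?_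
  split_ifs <;> fun_prop

theorem vertexPush_mem_stdSimplex {I V : Type*} [Fintype I] [Fintype V] (g : I → V) {x : I → ℝ}
    (hx : x ∈ stdSimplex ℝ I) : vertexPush g x ∈ stdSimplex ℝ V := by
  classical
  refine ⟨fun v => Finset.sum_nonneg fun i _ => ?_, ?_⟩
  · split_ifs
    exacts [hx.1 i, le_rfl]
  · simp only [vertexPush]
    rw [Finset.sum_comm]
    simpa using hx.2

theorem coordSupport_vertexPush {I V : Type*} [Fintype I] [Fintype V] [DecidableEq V] (g : I → V)
    (x : I → ℝ) : coordSupport (vertexPush g x) ⊆ (coordSupport x).image g := by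
  intro v hv
  rw [mem_coordSupport] at hv
  obtain ⟨i, -, hi⟩ := Finset.exists_ne_zero_of_sum_ne_zero hv
  rw [Finset.mem_image]
  split_ifs at hi with h
  · exact ⟨i, mem_coordSupport.2 hi, h⟩
  · exact absurd rfl hi

theorem mapsTo_vertexPush {I V : Type*} [Fintype I] [Fintype V] [DecidableEq V] {g : I → V}
    {L : Set (Finset I)} {K : Set (Finset V)} (hK : IsLowerSet K) (h : ∀ σ ∈ L, σ.image g ∈ K) :
    MapsTo (vertexPush g) (polyhedron L) (polyhedron K) := fun x hx =>
  ⟨vertexPush_mem_stdSimplex g hx.1, hK (coordSupport_vertexPush g x) (h _ hx.2)⟩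

/-- If the composite of simplicial maps `K → K' → K` is contiguous to the identity, then sphere
extension passes from `K'` to `K`. -/
theorem SphereExtends.of_contiguous {V V' : Type*} [Fintype V] [Fintype V'] [DecidableEq V]
    [DecidableEq V'] {K : Set (Finset V)} {K' : Set (Finset V')} (hK : IsLowerSet K)
    (hK' : IsLowerSet K') (r : V → V') (i : V' → V) (hr : ∀ σ ∈ K, σ.image r ∈ K')
    (hi : ∀ σ ∈ K', σ.image i ∈ K) (hri : ∀ σ ∈ K, σ ∪ (σ.image r).image i ∈ K) {d : ℕ}
    (h : SphereExtends d (polyhedron K')) : SphereExtends d (polyhedron K) := by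
  intro f hf hfK
  have hrm := mapsTo_vertexPush hK' hr
  have him := mapsTo_vertexPush hK hi
  obtain ⟨F, h1, h2, h3⟩ := h (fun x => vertexPush r (f x))
    ((continuous_vertexPush r).comp_continuousOn hf) (hrm.comp hfK)
  refine exists_extension_of_contiguous hK (G := fun x => vertexPush i (F x))
    ((continuous_vertexPush i).comp_continuousOn h1) (him.comp h2) hf hfK fun x hx => ?_
  refine ⟨_, hri _ (hfK hx).2, ?_, Finset.subset_union_left⟩
  rw [h3 hx]
  exact (coordSupport_vertexPush _ _).trans
    ((Finset.image_subset_image (coordSupport_vertexPush _ _)).trans Finset.subset_union_right)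

end SphereExtension

/-! ### Extension over a complex, simplex by simplex, inside carriers. -/

section CarrierExtension

open Set Metric

/-- A simplex with `d + 1` vertices is homeomorphic, as a pair with its boundary, to the `d`-ball. -/
theorem exists_simplex_ball_parametrization {V : Type*} [Fintype V] {σ : Finset V} {d : ℕ}
    (hσ : σ.card = d + 1) :
    ∃ (a : (V → ℝ) → Fin d → ℝ) (b : (Fin d → ℝ) → V → ℝ), Continuous a ∧ Continuous b ∧
      (∀ x ∈ polyhedron (Iic σ), b (a x) = x) ∧
      MapsTo a (polyhedron (Iic σ)) (closedBall 0 1) ∧ MapsTo a (polyhedron (Iio σ)) (sphere 0 1) ∧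
      MapsTo b (sphere 0 1) (polyhedron (Iio σ)) := by
  classical
  obtain ⟨β⟩ := AffineBasis.exists_affineBasis_of_finiteDimensional (ι := σ) (k := ℝ)
    (P := Fin d → ℝ) (by simp [hσ])
  set s : Set (Fin d → ℝ) := convexHull ℝ (range β) with hs
  have hint : interior s = {x | ∀ i, 0 < β.coord i x} := β.interior_convexHull
  have hcoord : s = {x | ∀ i, 0 ≤ β.coord i x} := β.convexHull_eq_nonneg_coord
  have hcomp : IsCompact s := (finite_range β).isCompact_convexHull ℝ
  have : Nonempty σ := by
    rw [Finset.nonempty_coe_sort, ← Finset.card_pos]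
    omega
  obtain ⟨h, -, h2, h3⟩ := exists_homeomorph_image_interior_closure_frontier_eq_unitBall
    (convex_convexHull ℝ (range β)) ⟨_, β.centroid_mem_interior_convexHull⟩ hcomp.isBounded
  rw [← hs, hcomp.isClosed.closure_eq] at h2
  rw [← hs, hcomp.isClosed.frontier_eq] at h3
  let c : (V → ℝ) → Fin d → ℝ := fun x => ∑ i : σ, x i • β i
  have hsum : ∀ x ∈ polyhedron (Iic σ), ∑ i : σ, x i = 1 := by
    intro x hx
    rw [Finset.sum_coe_sort σ x, ← hx.1.2]
    refine Finset.sum_subset (Finset.subset_univ _) fun v _ hv => ?_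
    by_contra hne
    exact hv (hx.2 (mem_coordSupport.2 hne))
  have hc : ∀ x ∈ polyhedron (Iic σ), ∀ i : σ, β.coord i (c x) = x i := by
    intro x hx i
    have := β.coord_apply_combination_of_mem (Finset.mem_univ i) (hsum x hx)
    rwa [Finset.affineCombination_eq_linear_combination _ _ _ (hsum x hx)] at this
  have hcs : ∀ x ∈ polyhedron (Iic σ), c x ∈ s := by
    intro x hx
    rw [hcoord]
    intro i
    rw [hc x hx]
    exact hx.1.1 i
  have hsub : polyhedron (Iio σ) ⊆ polyhedron (Iic σ) := polyhedron_mono Iio_subset_Iic_self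
  refine ⟨fun x => h (c x), fun y v => if hv : v ∈ σ then β.coord ⟨v, hv⟩ (h.symm y) else 0,
    ?_, ?_, ?_, ?_, ?_, ?_⟩
  · exact h.continuous.comp (by fun_prop)
  · refine continuous_pi fun v => ?_
    split_ifs with hv
    · exact (continuous_barycentric_coord β _).comp h.symm.continuous
    · exact continuous_const
  · intro x hx
    ext v
    simp only [Homeomorph.symm_apply_apply]
    split_ifs with hv
    · exact hc x hx ⟨v, hv⟩
    · by_contra hne
      exact hv (hx.2 (mem_coordSupport.2 (Ne.symm hne)))
  · intro x hx
    rw [← h2]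
    exact mem_image_of_mem h (hcs x hx)
  · intro x hx
    rw [← h3]
    refine mem_image_of_mem h ⟨hcs x (hsub hx), ?_⟩
    rw [hint]
    -- On the boundary some barycentric coordinate vanishes, so not all of them can be positive.
    intro hpos
    refine (mem_Iio.1 hx.2).not_ge fun v hv => ?_
    have := hpos ⟨v, hv⟩
    rw [hc x (hsub hx)] at this
    exact mem_coordSupport.2 this.ne'
  · intro y hy
    rw [← h3] at hy
    obtain ⟨z, ⟨hz, hz'⟩, rfl⟩ := hy
    simp only [Homeomorph.symm_apply_apply]
    rw [hint] at hz'
    rw [hcoord] at hz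
    simp only [mem_ofPred_eq, not_forall, not_lt] at hz'
    obtain ⟨i, hi⟩ := hz'
    refine ⟨⟨fun v => ?_, ?_⟩, ?_⟩
    · dsimp only
      split_ifs
      exacts [hz _, le_rfl]
    · rw [← β.sum_coord_apply_eq_one z, ← Finset.sum_subset (Finset.subset_univ σ),
        ← Finset.sum_coe_sort σ]
      · exact Finset.sum_congr rfl fun j _ => by simp
      · intro v _ hv
        simp [hv]
    · have hle : coordSupport (fun v => if hv : v ∈ σ then β.coord ⟨v, hv⟩ z else 0) ⊆ σ := by
        intro v hv
        by_contra hvσ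
        simp [hvσ] at hv
      refine mem_Iio.2 (lt_of_le_of_ne hle fun he => ?_)
      have := he.ge i.2
      rw [mem_coordSupport] at this
      simp only [Finset.coe_mem, dite_true] at this
      exact this (le_antisymm hi (hz i))

/-- `Iic σ` gives the closed simplex and `Iio σ` its boundary, so this is sphere extension
transported along the parametrization by the ball. -/
theorem SphereExtends.exists_extension_simplex {V E : Type*} [Fintype V] [TopologicalSpace E]
    {σ : Finset V} {d : ℕ} (hσ : σ.card = d + 1) {A : Set E} (hA : SphereExtends d A)
    {f : (V → ℝ) → E} (hf : ContinuousOn f (polyhedron (Iio σ)))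
    (hfA : MapsTo f (polyhedron (Iio σ)) A) :
    ∃ F : (V → ℝ) → E, ContinuousOn F (polyhedron (Iic σ)) ∧ MapsTo F (polyhedron (Iic σ)) A ∧
      EqOn F f (polyhedron (Iio σ)) := by
  obtain ⟨a, b, ha, hb, hba, ham, ham', hbm⟩ := exists_simplex_ball_parametrization hσ
  obtain ⟨F, h1, h2, h3⟩ := hA (fun y => f (b y)) (hf.comp hb.continuousOn hbm) (hfA.comp hbm)
  refine ⟨fun x => F (a x), h1.comp ha.continuousOn ham, h2.comp ham, fun x hx => ?_⟩
  dsimp only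
  rw [h3 (ham' hx)]
  dsimp only
  rw [hba x (polyhedron_mono Iio_subset_Iic_self hx)]

/-- A map on a subcomplex `M` that is carried by `C` extends to `L`, if the carriers of the
simplices of `L` outside `M` are sufficiently connected. -/
theorem exists_extension_of_carrier {V E : Type*} [Fintype V] [TopologicalSpace E]
    {C : Finset V → Set E} {L : Finset (Finset V)}
    (hL : IsLowerSet (L : Set (Finset V))) (hC : ∀ τ ∈ L, ∀ σ ⊆ τ, C σ ⊆ C τ)
    {M : Finset (Finset V)} (hM : IsLowerSet (M : Set (Finset V))) (hML : M ⊆ L)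
    (hM0 : ∅ ∈ M) (hext : ∀ σ ∈ L, σ ∉ M → SphereExtends (σ.card - 1) (C σ))
    {f : (V → ℝ) → E} (hf : ContinuousOn f (polyhedron (M : Set (Finset V))))
    (hfC : ∀ x ∈ polyhedron (M : Set (Finset V)), f x ∈ C (coordSupport x)) :
    ∃ F : (V → ℝ) → E, ContinuousOn F (polyhedron (L : Set (Finset V))) ∧
      (∀ x ∈ polyhedron (L : Set (Finset V)), F x ∈ C (coordSupport x)) ∧
      EqOn F f (polyhedron (M : Set (Finset V))) := by
  classical
  induction hn : (L \ M).card generalizing M f with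
  | zero =>
    rw [Finset.card_eq_zero, Finset.sdiff_eq_empty_iff_subset] at hn
    obtain rfl := hML.antisymm hn
    exact ⟨f, hf, hfC, fun _ _ => rfl⟩
  | succ n ih =>
    -- A missing simplex of least cardinality has its whole boundary in `M`.
    obtain ⟨σ, hσ, hmin⟩ := Finset.exists_min_image (L \ M) Finset.card
      (Finset.card_pos.1 (by omega))
    obtain ⟨hσL, hσM⟩ := Finset.mem_sdiff.1 hσ
    have hbd : Iio σ ⊆ (M : Set (Finset V)) := by
      intro τ hτ
      by_contra hτM
      have := hmin τ (Finset.mem_sdiff.2 ⟨hL (mem_Iio.1 hτ).le hσL, hτM⟩)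
      exact this.not_gt (Finset.card_lt_card (mem_Iio.1 hτ))
    -- Since `∅ ∈ M`, the subtraction in `σ.card - 1` is not truncated.
    have hσ0 : σ.Nonempty := by
      rw [Finset.nonempty_iff_ne_empty]
      rintro rfl
      exact hσM hM0
    have hcard : σ.card = (σ.card - 1) + 1 := by
      have := hσ0.card_pos
      omega
    obtain ⟨g, hg1, hg2, hg3⟩ := (hext σ hσL hσM).exists_extension_simplex hcard
      (hf.mono (polyhedron_mono hbd))
      (fun x hx => hC σ hσL _ (mem_Iio.1 hx.2).le (hfC x (polyhedron_mono hbd hx)))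
    have hM' : IsLowerSet ((insert σ M : Finset (Finset V)) : Set (Finset V)) := by
      intro τ ρ hρ hτ
      rw [Finset.mem_coe, Finset.mem_insert] at hτ ⊢
      rcases hτ with rfl | hτ
      · rcases eq_or_lt_of_le hρ with h | h
        exacts [Or.inl h, Or.inr (hbd h)]
      · exact Or.inr (hM hρ hτ)
    have hunion : polyhedron ((insert σ M : Finset (Finset V)) : Set (Finset V)) =
        polyhedron (M : Set (Finset V)) ∪ polyhedron (Iic σ) := by
      ext x
      constructor
      · rintro ⟨h1, h2⟩
        rw [Finset.mem_coe, Finset.mem_insert] at h2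
        rcases h2 with h2 | h2
        exacts [Or.inr ⟨h1, h2.le⟩, Or.inl ⟨h1, h2⟩]
      · rintro (⟨h1, h2⟩ | ⟨h1, h2⟩)
        exacts [⟨h1, Finset.mem_insert_of_mem h2⟩, ⟨h1, hM' h2 (Finset.mem_insert_self _ _)⟩]
    let f' : (V → ℝ) → E := fun x => if coordSupport x ∈ M then f x else g x
    have hf'M : EqOn f' f (polyhedron (M : Set (Finset V))) := fun x hx => if_pos hx.2
    have hf'σ : EqOn f' g (polyhedron (Iic σ)) := by
      intro x hx
      by_cases h : coordSupport x ∈ M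
      · have : coordSupport x < σ := lt_of_le_of_ne hx.2 fun he => hσM (he ▸ h)
        simp only [f', if_pos h]
        exact (hg3 ⟨hx.1, this⟩).symm
      · simp only [f', if_neg h]
    obtain ⟨F, hF1, hF2, hF3⟩ := ih (M := insert σ M) (f := f') hM'
      (Finset.insert_subset hσL hML) (Finset.mem_insert_of_mem hM0)
      (fun τ hτ hτM => hext τ hτ fun h => hτM (Finset.mem_insert_of_mem h))
      (by
        rw [hunion]
        exact (hf.congr hf'M).union_of_isClosed (hg1.congr hf'σ) (isClosed_polyhedron hM)
          (isClosed_polyhedron (isLowerSet_Iic σ)))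
      (by
        intro x hx
        by_cases h : coordSupport x ∈ M
        · rw [hf'M ⟨hx.1, h⟩]
          exact hfC x ⟨hx.1, h⟩
        · have he : coordSupport x = σ := by
            have := hx.2
            rw [Finset.mem_coe, Finset.mem_insert] at this
            exact this.resolve_right h
          rw [hf'σ ⟨hx.1, he.le⟩, he]
          exact hg2 ⟨hx.1, he.le⟩)
      (by
        rw [Finset.sdiff_insert, Finset.card_erase_of_mem hσ]
        omega)
    refine ⟨F, hF1, hF2, fun x hx => ?_⟩
    rw [hF3 (polyhedron_mono (Finset.coe_subset.2 (Finset.subset_insert _ _)) hx), hf'M hx]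

end CarrierExtension

/-! ### Simplicial approximation on the boundary of a cube. -/

section Approximation

open Set Metric

/-- The hat function at the lattice point `v` of the Freudenthal triangulation of `ℝ^d`. -/
noncomputable def latticeHat {d : ℕ} (v : Fin d → ℤ) (y : Fin d → ℝ) : ℝ :=
  max 0 (1 - ‖fun i => max (y i - v i) 0‖ - ‖fun i => max (v i - y i) 0‖)

theorem continuous_latticeHat {d : ℕ} (v : Fin d → ℤ) : Continuous (latticeHat v) := by
  unfold latticeHat
  fun_prop

theorem latticeHat_nonneg {d : ℕ} (v : Fin d → ℤ) (y : Fin d → ℝ) : 0 ≤ latticeHat v y :=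
  le_max_left _ _

theorem le_norm_posPart_apply {d : ℕ} (z : Fin d → ℝ) (i : Fin d) :
    z i ≤ ‖fun j => max (z j) 0‖ :=
  (le_max_left _ _).trans ((le_abs_self _).trans (norm_le_pi_norm (fun j => max (z j) 0) i))

theorem abs_sub_lt_one_of_latticeHat_pos {d : ℕ} {v : Fin d → ℤ} {y : Fin d → ℝ}
    (h : 0 < latticeHat v y) (i : Fin d) : |y i - v i| < 1 := by
  have h' := (lt_max_iff.1 h).resolve_left (lt_irrefl _)
  have h1 := le_norm_posPart_apply (fun i => y i - v i) i
  have h2 := le_norm_posPart_apply (fun i => v i - y i) i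
  have h3 := norm_nonneg fun i => max (y i - v i) 0
  have h4 := norm_nonneg fun i => max (v i - y i) 0
  rw [abs_lt]
  constructor <;> linarith

/-- Adding the two positivity conditions cancels `y` and bounds an integer strictly by 2.
Consequently `v` and `w` are comparable: `v i > w i` and `w j > v j` cannot both hold, so the
vertices of a simplex form a chain. -/
theorem sub_add_sub_le_one_of_latticeHat_pos {d : ℕ} {v w : Fin d → ℤ} {y : Fin d → ℝ}
    (hv : 0 < latticeHat v y) (hw : 0 < latticeHat w y) (i j : Fin d) :
    (v i - w i) + (w j - v j) ≤ 1 := by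
  have hv' := (lt_max_iff.1 hv).resolve_left (lt_irrefl _)
  have hw' := (lt_max_iff.1 hw).resolve_left (lt_irrefl _)
  have h1 := le_norm_posPart_apply (fun i => y i - v i) j
  have h2 := le_norm_posPart_apply (fun i => v i - y i) i
  have h3 := le_norm_posPart_apply (fun i => y i - w i) i
  have h4 := le_norm_posPart_apply (fun i => w i - y i) j
  have : (((v i - w i) + (w j - v j) : ℤ) : ℝ) < 2 := by
    push_cast
    linarith
  have h5 : (v i - w i) + (w j - v j) < 2 := by exact_mod_cast this
  omega

theorem sub_le_one_of_latticeHat_pos {d : ℕ} {v w : Fin d → ℤ} {y : Fin d → ℝ}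
    (hv : 0 < latticeHat v y) (hw : 0 < latticeHat w y) (i : Fin d) : v i - w i ≤ 1 := by
  have h1 := abs_lt.1 (abs_sub_lt_one_of_latticeHat_pos hv i)
  have h2 := abs_lt.1 (abs_sub_lt_one_of_latticeHat_pos hw i)
  have : ((v i - w i : ℤ) : ℝ) < 2 := by
    push_cast
    linarith
  have h5 : v i - w i < 2 := by exact_mod_cast this
  omega

/-- Some hat is nonzero at every point, so the hats can be normalised to a partition of unity. -/
theorem latticeHat_floor_pos {d : ℕ} (y : Fin d → ℝ) : 0 < latticeHat (fun i => ⌊y i⌋) y := by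
  refine lt_max_of_lt_right ?_
  have h1 : ‖fun i => max (y i - ⌊y i⌋) 0‖ < 1 := by
    rw [pi_norm_lt_iff one_pos]
    intro i
    rw [max_eq_left (sub_nonneg.2 (Int.floor_le _)), Real.norm_eq_abs,
      abs_of_nonneg (sub_nonneg.2 (Int.floor_le _))]
    linarith [Int.lt_floor_add_one (y i)]
  have h2 : (fun i => max (⌊y i⌋ - y i) 0) = (0 : Fin d → ℝ) := by
    ext i
    exact max_eq_right (sub_nonpos.2 (Int.floor_le _))
  rw [h2, norm_zero]
  linarith

/-- At a point with an integer coordinate, at most `d` hat functions are nonzero. -/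
theorem card_le_of_latticeHat_pos {d : ℕ} {y : Fin d → ℝ} {i₀ : Fin d} {z : ℤ} (hz : y i₀ = z)
    {τ : Finset (Fin d → ℤ)} (hτ : ∀ v ∈ τ, 0 < latticeHat v y) : τ.card ≤ d := by
  classical
  rcases τ.eq_empty_or_nonempty with rfl | hne
  · simp
  have hi₀ : ∀ v ∈ τ, v i₀ = z := by
    intro v hv
    have := abs_sub_lt_one_of_latticeHat_pos (hτ v hv) i₀
    rw [hz] at this
    have h : |z - v i₀| < 1 := by exact_mod_cast this
    rw [Int.abs_lt_one_iff] at h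
    omega
  obtain ⟨u, hu, hmin⟩ := Finset.exists_min_image τ (fun v => ∑ i, v i) hne
  -- Each coordinate exceeds that of `u` by at most 1, and coordinate `i₀` does not vary, so only
  -- `d` coordinate sums are possible.
  have hmaps : ∀ v ∈ τ, ∑ i, v i ∈ Finset.Ico (∑ i, u i) (∑ i, u i + d) := by
    intro v hv
    refine Finset.mem_Ico.2 ⟨hmin v hv, ?_⟩
    have hlt : ∑ i, v i < ∑ i, (u i + 1) := by
      refine Finset.sum_lt_sum (fun i _ => ?_) ⟨i₀, Finset.mem_univ _, ?_⟩
      · linarith [sub_le_one_of_latticeHat_pos (hτ v hv) (hτ u hu) i]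
      · rw [hi₀ v hv, hi₀ u hu]
        omega
    simpa [Finset.sum_add_distrib] using hlt
  -- In a chain the coordinate sum determines the vector.
  have hinj : Set.InjOn (fun v : Fin d → ℤ => ∑ i, v i) τ := by
    have key : ∀ v ∈ τ, ∀ w ∈ τ, ∑ i, v i = ∑ i, w i → v ≤ w → v = w := by
      intro v _ w _ h hle
      ext i
      exact (Finset.sum_eq_sum_iff_of_le fun i _ => hle i).1 h i (Finset.mem_univ i)
    intro v hv w hw h
    by_cases hle : v ≤ w
    · exact key v hv w hw h hle
    · rw [Pi.le_def, not_forall] at hle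
      obtain ⟨i, hi⟩ := hle
      refine (key w hw v hv h.symm fun j => ?_).symm
      have := sub_add_sub_le_one_of_latticeHat_pos (hτ v hv) (hτ w hw) i j
      change w j ≤ v j
      omega
  simpa using Finset.card_le_card_of_injOn _ hmaps hinj

theorem exists_abs_apply_eq_one {d : ℕ} {x : Fin d → ℝ} (hx : x ∈ sphere (0 : Fin d → ℝ) 1) :
    ∃ i, |x i| = 1 := by
  have hx' : ‖x‖ = 1 := by simpa using hx
  by_contra! h
  have : ‖x‖ < 1 := (pi_norm_lt_iff one_pos).2 fun i =>
    lt_of_le_of_ne (hx' ▸ norm_le_pi_norm x i) (h i)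
  linarith

/-- A map from the sphere to a polyhedron is contiguous to one factoring through a simplicial map
from a complex of dimension less than `d`. -/
theorem exists_simplicial_approximation {V : Type*} [Fintype V] [DecidableEq V]
    {K : Set (Finset V)} (hK : IsLowerSet K) (hK0 : ∅ ∈ K) {d : ℕ} {f : (Fin d → ℝ) → V → ℝ}
    (hf : ContinuousOn f (sphere 0 1)) (hfK : MapsTo f (sphere 0 1) (polyhedron K)) :
    ∃ (I : Type) (_ : Fintype I) (_ : DecidableEq I) (L : Set (Finset I)) (g : I → V)
      (p : (Fin d → ℝ) → I → ℝ), IsLowerSet L ∧ ∅ ∈ L ∧ (∀ τ ∈ L, τ.card ≤ d) ∧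
      (∀ τ ∈ L, τ.image g ∈ K) ∧ ContinuousOn p (sphere 0 1) ∧
      MapsTo p (sphere 0 1) (polyhedron L) ∧
      ∀ x ∈ sphere (0 : Fin d → ℝ) 1, ∀ i, p x i ≠ 0 → f x (g i) ≠ 0 := by
  classical
  -- The coordinates of `f x` sum to 1, which is more than `|V| ε`, so one of them exceeds `ε`.
  set ε : ℝ := 1 / (Fintype.card V + 1) with hε
  have hε0 : 0 < ε := by positivity
  have hbig : ∀ x ∈ sphere (0 : Fin d → ℝ) 1, ∃ v, ε < f x v := by
    intro x hx
    by_contra! h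
    have h1 : ∑ v, f x v ≤ ∑ _v : V, ε := Finset.sum_le_sum fun v _ => h v
    rw [(hfK hx).1.2, Finset.sum_const, Finset.card_univ, nsmul_eq_mul, hε, mul_one_div,
      le_div_iff₀ (by positivity)] at h1
    linarith
  obtain ⟨δ, hδ, huc⟩ := Metric.uniformContinuousOn_iff.1
    ((isCompact_sphere (0 : Fin d → ℝ) 1).uniformContinuousOn_of_continuous hf) ε hε0
  -- After scaling by `m`, two points in the star of one lattice point are within `2 / m < δ`. As
  -- `m` is an integer, the scaled sup-norm sphere consists of points with a coordinate `±m`, which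
  -- lowers the dimension by one.
  obtain ⟨m, hm⟩ := exists_nat_gt (2 / δ)
  have hm0 : (0 : ℝ) < m := (by positivity : 0 < 2 / δ).trans hm
  let T : Set (Fin d → ℤ) := {v | ∃ x ∈ sphere (0 : Fin d → ℝ) 1, 0 < latticeHat v ((m : ℝ) • x)}
  have hTfin : T.Finite := by
    refine (Set.finite_Icc (fun _ : Fin d => -(m + 1 : ℤ)) fun _ => (m + 1 : ℤ)).subset ?_
    rintro v ⟨x, hx, hv⟩
    have hb : ∀ i, |v i| ≤ (m + 1 : ℤ) := by
      intro i
      have h1 := abs_sub_lt_one_of_latticeHat_pos hv i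
      have h2 : |x i| ≤ 1 := by
        have hx' : ‖x‖ = 1 := by simpa using hx
        exact hx' ▸ norm_le_pi_norm x i
      rw [abs_lt] at h1
      rw [abs_le] at h2
      simp only [Pi.smul_apply, smul_eq_mul] at h1
      have h3 : |(v i : ℝ)| ≤ m + 1 := by
        rw [abs_le]
        constructor <;> nlinarith
      exact_mod_cast h3
    exact ⟨fun i => (abs_le.1 (hb i)).1, fun i => (abs_le.1 (hb i)).2⟩
  have hTfintype : Fintype T := hTfin.fintype
  have hclose : ∀ v : Fin d → ℤ, ∀ x y : Fin d → ℝ, 0 < latticeHat v ((m : ℝ) • x) →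
      0 < latticeHat v ((m : ℝ) • y) → dist x y < δ := by
    intro v x y hx hy
    rw [dist_pi_lt_iff hδ]
    intro i
    have h1 := abs_lt.1 (abs_sub_lt_one_of_latticeHat_pos hx i)
    have h2 := abs_lt.1 (abs_sub_lt_one_of_latticeHat_pos hy i)
    simp only [Pi.smul_apply, smul_eq_mul] at h1 h2
    rw [div_lt_iff₀ hδ] at hm
    rw [Real.dist_eq, abs_lt]
    constructor <;> nlinarith
  choose q hqS hq using fun v : T => v.2
  -- A coordinate larger than `ε` at the sample point `q v` stays nonzero on the whole star of `v`.
  choose g hg using fun v : T => hbig (q v) (hqS v)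
  have hgf : ∀ v : T, ∀ x ∈ sphere (0 : Fin d → ℝ) 1, 0 < latticeHat v ((m : ℝ) • x) →
      f x (g v) ≠ 0 := by
    intro v x hx hvx h0
    have h1 := (dist_le_pi_dist (f (q v)) (f x) (g v)).trans_lt
      (huc _ (hqS v) _ hx (hclose v _ _ (hq v) hvx))
    rw [Real.dist_eq, h0, sub_zero] at h1
    exact (h1.trans (hg v)).not_ge (le_abs_self _)
  let s : (Fin d → ℝ) → ℝ := fun x => ∑ v : T, latticeHat v ((m : ℝ) • x)
  have hs : ∀ x ∈ sphere (0 : Fin d → ℝ) 1, 0 < s x := by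
    intro x hx
    have h := latticeHat_floor_pos ((m : ℝ) • x)
    exact Finset.sum_pos' (fun v _ => latticeHat_nonneg _ _) ⟨⟨_, x, hx, h⟩, Finset.mem_univ _, h⟩
  have hcont : ∀ v : Fin d → ℤ, Continuous fun x => latticeHat v ((m : ℝ) • x) := fun v =>
    (continuous_latticeHat v).comp (continuous_const_smul _)
  let p : (Fin d → ℝ) → T → ℝ := fun x v => latticeHat v ((m : ℝ) • x) / s x
  have hp : ∀ x (v : T), p x v ≠ 0 → 0 < latticeHat v ((m : ℝ) • x) := by
    intro x v h
    refine lt_of_le_of_ne (latticeHat_nonneg _ _) fun h0 => h ?_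
    simp [p, ← h0]
  refine ⟨T, hTfintype, inferInstance, {τ | τ = ∅ ∨ ∃ x ∈ sphere (0 : Fin d → ℝ) 1,
    ∀ v ∈ τ, 0 < latticeHat v.1 ((m : ℝ) • x)}, g, p, ?_, Or.inl rfl, ?_, ?_, ?_, ?_, ?_⟩
  · rintro σ τ hτσ (rfl | ⟨x, hx, h⟩)
    · exact Or.inl (Finset.subset_empty.1 hτσ)
    · exact Or.inr ⟨x, hx, fun v hv => h v (hτσ hv)⟩
  · rintro τ (rfl | ⟨x, hx, h⟩)
    · simp
    · obtain ⟨i, hi⟩ := exists_abs_apply_eq_one hx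
      rw [← Finset.card_map (Function.Embedding.subtype _)]
      have hτ : ∀ v ∈ τ.map (Function.Embedding.subtype (· ∈ T)),
          0 < latticeHat v ((m : ℝ) • x) := by
        intro v hv
        obtain ⟨w, hw, rfl⟩ := Finset.mem_map.1 hv
        exact h w hw
      rcases eq_or_eq_neg_of_abs_eq hi with hi | hi
      · exact card_le_of_latticeHat_pos (i₀ := i) (z := m) (by simp [hi]) hτ
      · exact card_le_of_latticeHat_pos (i₀ := i) (z := -m) (by simp [hi]) hτ
  · rintro τ (rfl | ⟨x, hx, h⟩)
    · simpa using hK0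
    · refine hK (fun w hw => ?_) (hfK hx).2
      obtain ⟨v, hv, rfl⟩ := Finset.mem_image.1 hw
      exact mem_coordSupport.2 (hgf v x hx (h v hv))
  · refine continuousOn_pi.2 fun v => (hcont v).continuousOn.div ?_ fun x hx => (hs x hx).ne'
    exact (continuous_finsetSum Finset.univ fun w : T => fun _ => hcont w).continuousOn
  · intro x hx
    refine ⟨⟨fun v => div_nonneg (latticeHat_nonneg _ _) (hs x hx).le, ?_⟩, Or.inr ⟨x, hx, ?_⟩⟩
    · simp only [p]
      rw [← Finset.sum_div, div_self (hs x hx).ne']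
    · intro v hv
      exact hp x v (mem_coordSupport.1 hv)
  · intro x hx v hv
    exact hgf v x hx (hp x v hv)

end Approximation

/-! ### Cones and the gluing of subcomplexes. -/

section Gluing

open Set Metric

/-- The cone, with apex `none`, over a family of finite sets. -/
def coneFaces {I : Type*} (L : Set (Finset I)) : Set (Finset (Option I)) :=
  {τ | Finset.eraseNone τ ∈ L}

theorem IsLowerSet.coneFaces {I : Type*} {L : Set (Finset I)} (hL : IsLowerSet L) :
    IsLowerSet (coneFaces L) := fun _ _ h hτ => hL (Finset.eraseNone.monotone h) hτ

/-- A map from the sphere to `L` extends radially to a map from the ball to the cone over `L`. -/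
theorem exists_radial_extension {I : Type*} [Fintype I] {L : Set (Finset I)} (hL : IsLowerSet L)
    (hL0 : ∅ ∈ L) {d : ℕ} {p : (Fin d → ℝ) → I → ℝ} (hp : ContinuousOn p (sphere 0 1))
    (hpL : MapsTo p (sphere 0 1) (polyhedron L)) :
    ∃ P : (Fin d → ℝ) → Option I → ℝ, ContinuousOn P (closedBall 0 1) ∧
      MapsTo P (closedBall 0 1) (polyhedron (coneFaces L)) ∧
      ∀ x ∈ sphere (0 : Fin d → ℝ) 1, P x none = 0 ∧ ∀ i, P x (some i) = p x i := by
  have hnorm : ∀ x : Fin d → ℝ, x ≠ 0 → ‖x‖⁻¹ • x ∈ sphere (0 : Fin d → ℝ) 1 := by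
    intro x hx
    simp [norm_smul, hx]
  -- At the origin the value `p 0` is arbitrary but is multiplied by zero; continuity there uses
  -- that the coordinates of `p` on the sphere are at most 1.
  refine ⟨fun x o => o.elim (1 - ‖x‖) fun i => ‖x‖ * p (‖x‖⁻¹ • x) i, ?_, ?_, ?_⟩
  · refine continuousOn_pi.2 fun o => ?_
    cases o with
    | none => exact (continuous_const.sub continuous_norm).continuousOn
    | some i =>
      refine Continuous.continuousOn (continuous_iff_continuousAt.2 fun x => ?_)
      simp only [Option.elim_some]
      by_cases hx : x = 0
      · subst hx
        rw [ContinuousAt, norm_zero, zero_mul]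
        refine squeeze_zero_norm (a := fun x : Fin d → ℝ => ‖x‖) (fun x => ?_) ?_
        · by_cases h : x = 0
          · simp [h]
          · have hm := (hpL (hnorm x h)).1
            rw [norm_mul, norm_norm]
            refine mul_le_of_le_one_right (norm_nonneg _) ?_
            rw [Real.norm_eq_abs, abs_of_nonneg (hm.1 i), ← hm.2]
            exact Finset.single_le_sum (fun j _ => hm.1 j) (Finset.mem_univ i)
        · simpa using (continuous_norm (E := Fin d → ℝ)).tendsto 0
      · have h1 : ContinuousOn (fun x : Fin d → ℝ => ‖x‖⁻¹ • x) {0}ᶜ :=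
          (continuousOn_id.norm.inv₀ fun y hy => norm_ne_zero_iff.2 hy).smul continuousOn_id
        have h2 : ContinuousOn (fun x : Fin d → ℝ => ‖x‖ * p (‖x‖⁻¹ • x) i) {0}ᶜ :=
          continuousOn_id.norm.mul (continuousOn_pi.1 (hp.comp h1 fun y hy => hnorm y hy) i)
        exact h2.continuousAt (isOpen_compl_singleton.mem_nhds hx)
  · intro x hx
    have hx1 : ‖x‖ ≤ 1 := by simpa using hx
    by_cases h : x = 0
    · subst h
      refine ⟨⟨fun o => ?_, ?_⟩, ?_⟩
      · cases o <;> simp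
      · simp [Fintype.sum_option]
      · have : Finset.eraseNone (coordSupport fun o : Option I =>
            o.elim (1 - ‖(0 : Fin d → ℝ)‖) fun i => ‖(0 : Fin d → ℝ)‖ *
              p (‖(0 : Fin d → ℝ)‖⁻¹ • (0 : Fin d → ℝ)) i) = ∅ := by
          ext i
          simp
        rw [coneFaces, mem_ofPred_eq, this]
        exact hL0
    · have hm := hpL (hnorm x h)
      refine ⟨⟨fun o => ?_, ?_⟩, ?_⟩
      · cases o with
        | none => simpa using hx1
        | some i => exact mul_nonneg (norm_nonneg _) (hm.1.1 i)
      · simp only [Fintype.sum_option, Option.elim_none, Option.elim_some, ← Finset.mul_sum]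
        rw [hm.1.2]
        ring
      · refine hL (fun i hi => ?_) hm.2
        rw [Finset.mem_eraseNone, mem_coordSupport] at hi
        exact mem_coordSupport.2 (right_ne_zero_of_mul hi)
  · intro x hx
    have hx1 : ‖x‖ = 1 := by simpa using hx
    simp [hx1]

/-- If the subcomplexes `B j` meet pairwise in the common subcomplex `A`, their union is as
connected as the `B j`, provided that `A` is at most one step less connected. -/
theorem SphereExtends.iUnion {V J : Type*} [Fintype V] [DecidableEq V] [Nonempty J]
    {A : Set (Finset V)} {B : J → Set (Finset V)} (hA : IsLowerSet A) (hA0 : ∅ ∈ A)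
    (hB : ∀ j, IsLowerSet (B j)) (hAB : ∀ j, A ⊆ B j)
    (hinter : ∀ i j, i ≠ j → B i ∩ B j ⊆ A) {d : ℕ}
    (hBd : ∀ j, ∀ e ≤ d, SphereExtends e (polyhedron (B j)))
    (hAd : ∀ e < d, SphereExtends e (polyhedron A)) :
    SphereExtends d (polyhedron (⋃ j, B j)) := by
  classical
  have hK : IsLowerSet (⋃ j, B j) := isLowerSet_iUnion hB
  intro f hf hfK
  obtain ⟨I, _, _, L, g, p, hL, hL0, hLd, hgK, hp, hpL, hpf⟩ := exists_simplicial_approximation hK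
    (mem_iUnion.2 ⟨Classical.arbitrary J, hAB _ hA0⟩) hf hfK
  choose c hc using fun τ : L => mem_iUnion.1 (hgK τ.1 τ.2)
  -- The cone over `τ` needs extension from `S^{|τ|-1}`. For `A` this is available only if `|τ| <
  -- d`, so a top simplex is assigned a piece `B j` even when its image lies in `A`.
  let D : Finset I → Set (Finset V) := fun τ =>
    if τ.image g ∈ A ∧ τ.card < d then A else if h : τ ∈ L then B (c ⟨τ, h⟩) else A
  have hD1 : ∀ τ, τ.image g ∈ A → τ.card < d → D τ = A := fun τ h1 h2 => if_pos ⟨h1, h2⟩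
  have hD2 : ∀ τ (hτ : τ ∈ L), ¬ (τ.image g ∈ A ∧ τ.card < d) → D τ = B (c ⟨τ, hτ⟩) :=
    fun τ hτ h => by simp only [D, if_neg h, dif_pos hτ]
  have hDlower : ∀ τ, IsLowerSet (D τ) := by
    intro τ
    simp only [D]
    split_ifs
    exacts [hA, hB _, hA]
  have hAD : ∀ τ, A ⊆ D τ := by
    intro τ
    simp only [D]
    split_ifs
    exacts [Subset.rfl, hAB _, Subset.rfl]
  have hDK : ∀ τ, D τ ⊆ ⋃ j, B j := by
    intro τ
    simp only [D]
    split_ifs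
    exacts [(hAB (Classical.arbitrary J)).trans (subset_iUnion B _), subset_iUnion B _,
      (hAB (Classical.arbitrary J)).trans (subset_iUnion B _)]
  have hgD : ∀ τ ∈ L, τ.image g ∈ D τ := by
    intro τ hτ
    by_cases h : τ.image g ∈ A ∧ τ.card < d
    · exact hAD τ h.1
    · rw [hD2 τ hτ h]
      exact hc ⟨τ, hτ⟩
  have hDmono : ∀ τ ∈ L, ∀ σ ⊆ τ, D σ ⊆ D τ := by
    intro τ hτ σ hστ
    rcases eq_or_ne σ τ with rfl | hne
    · exact Subset.rfl
    have hcard : σ.card < d :=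
      (Finset.card_lt_card (Finset.ssubset_iff_subset_ne.2 ⟨hστ, hne⟩)).trans_le (hLd τ hτ)
    by_cases hσA : σ.image g ∈ A
    · rw [hD1 σ hσA hcard]
      exact hAD τ
    · have hσL : σ ∈ L := hL hστ hτ
      have hτA : τ.image g ∉ A := fun h => hσA (hA (Finset.image_subset_image hστ) h)
      rw [hD2 σ hσL fun h => hσA h.1, hD2 τ hτ fun h => hτA h.1]
      -- Different indices would put the image of `σ` in two pieces, hence in `A`.
      by_cases hcc : c ⟨σ, hσL⟩ = c ⟨τ, hτ⟩
      · rw [hcc]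
      · exact absurd (hinter _ _ hcc ⟨hc ⟨σ, hσL⟩, hB _ (Finset.image_subset_image hστ)
          (hc ⟨τ, hτ⟩)⟩) hσA
  let cone : Finset (Finset (Option I)) := (Set.toFinite (coneFaces L)).toFinset
  have hcone : (cone : Set (Finset (Option I))) = coneFaces L := Set.Finite.coe_toFinset _
  let base : Finset (Finset (Option I)) := cone.filter fun τ => none ∉ τ
  have hcone_mem : ∀ {τ}, τ ∈ cone ↔ Finset.eraseNone τ ∈ L := fun {τ} => by
    rw [← Finset.mem_coe, hcone]
    rfl
  have hbase_mem : ∀ {τ}, τ ∈ base ↔ Finset.eraseNone τ ∈ L ∧ none ∉ τ := fun {τ} => by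
    simp [base, hcone_mem]
  obtain ⟨F, hF1, hF2, hF3⟩ := exists_extension_of_carrier
    (C := fun τ => polyhedron (D (Finset.eraseNone τ))) (L := cone) (M := base)
    (f := fun x : Option I → ℝ => vertexPush g fun i => x (some i))
    (by rw [hcone]; exact hL.coneFaces)
    (fun τ hτ σ hστ => polyhedron_mono
      (hDmono _ (hcone_mem.1 hτ) _ (Finset.eraseNone.monotone hστ)))
    (by
      intro τ σ hστ hτ
      rw [Finset.mem_coe, hbase_mem] at hτ ⊢
      exact ⟨hL (Finset.eraseNone.monotone hστ) hτ.1, fun h => hτ.2 (hστ h)⟩)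
    (Finset.filter_subset _ _)
    (hbase_mem.2 ⟨by simpa using hL0, by simp⟩)
    (by
      intro σ hσ hσb
      have hσL := hcone_mem.1 hσ
      have hnone : none ∈ σ := by
        by_contra h
        exact hσb (hbase_mem.2 ⟨hσL, h⟩)
      rw [← Finset.card_eraseNone_of_mem hnone]
      by_cases h : (Finset.eraseNone σ).image g ∈ A ∧ (Finset.eraseNone σ).card < d
      · rw [hD1 _ h.1 h.2]
        exact hAd _ h.2
      · rw [hD2 _ hσL h]
        exact hBd _ _ (hLd _ hσL))
    ((continuous_vertexPush g).comp (by fun_prop)).continuousOn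
    (by
      intro x hx
      have hx2 := hbase_mem.1 hx.2
      have hx0 : x none = 0 := by simpa using hx2.2
      have hsum := hx.1.2
      rw [Fintype.sum_option, hx0, zero_add] at hsum
      refine ⟨vertexPush_mem_stdSimplex g ⟨fun i => hx.1.1 _, hsum⟩, ?_⟩
      refine hDlower _ (coordSupport_vertexPush g _) ?_
      have he : (coordSupport fun i => x (some i)) = Finset.eraseNone (coordSupport x) := by
        ext i
        simp
      rw [he]
      exact hgD _ hx2.1)
  obtain ⟨P, hP1, hP2, hP3⟩ := exists_radial_extension hL hL0 hp hpL
  rw [hcone] at hF1 hF2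
  -- On the sphere `F (P x)` is the simplicial approximation, whose support lies in that of `f x`.
  refine exists_extension_of_contiguous hK (G := fun x => F (P x)) (hF1.comp hP1 hP2)
    (fun x hx => polyhedron_mono (hDK _) (hF2 _ (hP2 hx))) hf hfK
    fun x hx => ⟨_, (hfK hx).2, ?_, Finset.Subset.rfl⟩
  obtain ⟨h0, hi⟩ := hP3 x hx
  have hPx := hP2 (sphere_subset_closedBall hx)
  have hPb : P x ∈ polyhedron (base : Set (Finset (Option I))) :=
    ⟨hPx.1, hbase_mem.2 ⟨hPx.2, by simp [h0]⟩⟩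
  rw [hF3 hPb]
  refine (coordSupport_vertexPush g _).trans fun v hv => ?_
  obtain ⟨i, hi', rfl⟩ := Finset.mem_image.1 hv
  rw [mem_coordSupport, hi] at hi'
  exact mem_coordSupport.2 (hpf x hx i hi')

end Gluing

/-! ### The covering complexes and the induction on `n`. -/

section CoveringComplex

open Set Metric

/-- Sets of maps `[n] → [k]` for which every `i ∈ S` is attained by all members at a common
point. -/
def coverFaces (n k : ℕ) (S : Finset (Fin k)) : Set (Finset (Fin n → Fin k)) :=
  {σ | σ.Nonempty → ∀ i ∈ S, ∃ a, ∀ φ ∈ σ, φ a = i}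

theorem isLowerSet_coverFaces {n k : ℕ} {S : Finset (Fin k)} : IsLowerSet (coverFaces n k S) := by
  intro σ τ hτσ hσ hτ i hi
  obtain ⟨a, ha⟩ := hσ (hτ.mono hτσ) i hi
  exact ⟨a, fun φ hφ => ha φ (hτσ hφ)⟩

theorem coverFaces_anti {n k : ℕ} {S T : Finset (Fin k)} (h : S ⊆ T) :
    coverFaces n k T ⊆ coverFaces n k S := fun _ hσ hne i hi => hσ hne i (h hi)

/-- Restriction of a map on `[n + 1]` to the nonzero elements. -/
def dropZero {n k : ℕ} (φ : Fin (n + 1) → Fin k) : Fin n → Fin k := fun a => φ a.succ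

/-- Extension of a map by the value `j` at zero. -/
def extendZero {n k : ℕ} (j : Fin k) (φ : Fin n → Fin k) : Fin (n + 1) → Fin k := Fin.cons j φ

theorem image_dropZero_extendZero {n k : ℕ} (j : Fin k) (σ : Finset (Fin n → Fin k)) :
    (σ.image (extendZero j)).image dropZero = σ := by
  rw [Finset.image_image]
  exact Finset.image_id

/-- Sets of maps whose restrictions to the nonzero elements commonly cover `S`. -/
def coverOffZero (n k : ℕ) (S : Finset (Fin k)) : Set (Finset (Fin (n + 1) → Fin k)) :=
  {σ | σ.image dropZero ∈ coverFaces n k S}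

/-- Sets of maps that commonly cover `S`, using zero at most for the value `j`. -/
def coverZeroAt (n k : ℕ) (S : Finset (Fin k)) (j : Fin k) :
    Set (Finset (Fin (n + 1) → Fin k)) :=
  coverOffZero n k S ∪ {σ | (∀ φ ∈ σ, φ 0 = j) ∧ σ ∈ coverOffZero n k (S.erase j)}

theorem isLowerSet_coverOffZero {n k : ℕ} {S : Finset (Fin k)} :
    IsLowerSet (coverOffZero n k S) := fun _ _ h hσ =>
  isLowerSet_coverFaces (Finset.image_subset_image h) hσ

theorem isLowerSet_coverZeroAt {n k : ℕ} {S : Finset (Fin k)} {j : Fin k} :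
    IsLowerSet (coverZeroAt n k S j) :=
  isLowerSet_coverOffZero.union fun _ _ h hσ =>
    ⟨fun φ hφ => hσ.1 φ (h hφ), isLowerSet_coverOffZero h hσ.2⟩

/-- The added maps have the same restrictions to the nonzero elements. This is the contiguity of
resetting the value at zero to `j` with the identity. -/
theorem union_extendZero_mem_coverOffZero {n k : ℕ} {S : Finset (Fin k)} {j : Fin k}
    {σ : Finset (Fin (n + 1) → Fin k)} (hσ : σ ∈ coverOffZero n k S) :
    σ ∪ (σ.image dropZero).image (extendZero j) ∈ coverOffZero n k S := by
  change (σ ∪ (σ.image dropZero).image (extendZero j)).image dropZero ∈ coverFaces n k S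
  rw [Finset.image_union, image_dropZero_extendZero, Finset.union_idempotent]
  exact hσ

theorem image_extendZero_mem_coverOffZero {n k : ℕ} {S : Finset (Fin k)} {j : Fin k}
    {σ : Finset (Fin n → Fin k)} (hσ : σ ∈ coverFaces n k S) :
    σ.image (extendZero j) ∈ coverOffZero n k S := by
  change (σ.image (extendZero j)).image dropZero ∈ coverFaces n k S
  rwa [image_dropZero_extendZero]

theorem SphereExtends.coverOffZero {n k d : ℕ} {S : Finset (Fin k)} (j : Fin k)
    (h : SphereExtends d (polyhedron (coverFaces n k S))) :
    SphereExtends d (polyhedron (coverOffZero n k S)) :=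
  h.of_contiguous isLowerSet_coverOffZero isLowerSet_coverFaces dropZero (extendZero j)
    (fun _ hσ => hσ) (fun _ hσ => image_extendZero_mem_coverOffZero hσ)
    fun _ hσ => union_extendZero_mem_coverOffZero hσ

/-- Once every map takes the value `j` at zero, `j` is covered for free and only `S.erase j` must be
covered elsewhere. -/
theorem SphereExtends.coverZeroAt {n k d : ℕ} {S : Finset (Fin k)} {j : Fin k}
    (h : SphereExtends d (polyhedron (coverFaces n k (S.erase j)))) :
    SphereExtends d (polyhedron (coverZeroAt n k S j)) := by
  refine h.of_contiguous isLowerSet_coverZeroAt isLowerSet_coverFaces dropZero (extendZero j)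
    ?_ (fun σ hσ => Or.inr ⟨?_, image_extendZero_mem_coverOffZero hσ⟩) ?_
  · rintro σ (hσ | ⟨-, hσ⟩)
    exacts [coverFaces_anti (Finset.erase_subset _ _) hσ, hσ]
  · intro φ hφ
    obtain ⟨ψ, -, rfl⟩ := Finset.mem_image.1 hφ
    rfl
  · rintro σ (hσ | ⟨hσj, hσ⟩)
    · exact Or.inl (union_extendZero_mem_coverOffZero hσ)
    · refine Or.inr ⟨fun φ hφ => ?_, union_extendZero_mem_coverOffZero hσ⟩
      rcases Finset.mem_union.1 hφ with hφ | hφ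
      · exact hσj φ hφ
      · obtain ⟨ψ, -, rfl⟩ := Finset.mem_image.1 hφ
        rfl

theorem mem_coverOffZero_iff {n k : ℕ} {S : Finset (Fin k)} {σ : Finset (Fin (n + 1) → Fin k)} :
    σ ∈ coverOffZero n k S ↔ (σ.Nonempty → ∀ i ∈ S, ∃ a : Fin n, ∀ φ ∈ σ, φ a.succ = i) := by
  change σ.image dropZero ∈ coverFaces n k S ↔ _
  simp [coverFaces, dropZero]

theorem coverZeroAt_inter_subset {n k : ℕ} {S : Finset (Fin k)} {i j : Fin k} (hij : i ≠ j) :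
    coverZeroAt n k S i ∩ coverZeroAt n k S j ⊆ coverOffZero n k S := by
  rintro σ ⟨h | ⟨hi, -⟩, h' | ⟨hj, -⟩⟩
  · exact h
  · exact h
  · exact h'
  · rw [mem_coverOffZero_iff]
    rintro ⟨φ, hφ⟩
    exact absurd ((hi φ hφ).symm.trans (hj φ hφ)) hij

/-- If some `j ∈ S` is not commonly attained off zero, all maps take the value `j` at zero, and zero
cannot serve any other value. If there is no such `j`, the simplex lies in every piece. -/
theorem coverFaces_succ {n k : ℕ} {S : Finset (Fin k)} (hS : S.Nonempty) :
    coverFaces (n + 1) k S = ⋃ j : S, coverZeroAt n k S j := by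
  obtain ⟨j₀, hj₀⟩ := hS
  ext σ
  simp only [mem_iUnion]
  constructor
  · intro hσ
    by_cases h : σ ∈ coverOffZero n k S
    · exact ⟨⟨j₀, hj₀⟩, Or.inl h⟩
    · have h' := h
      rw [mem_coverOffZero_iff] at h
      push Not at h
      obtain ⟨hne, j, hj, hno⟩ := h
      have hzero : ∀ φ ∈ σ, φ 0 = j := by
        obtain ⟨a, ha⟩ := hσ hne j hj
        cases a using Fin.cases with
        | zero => exact ha
        | succ a =>
          obtain ⟨φ, hφ, hφa⟩ := hno a
          exact absurd (ha φ hφ) hφa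
      refine ⟨⟨j, hj⟩, Or.inr ⟨hzero, mem_coverOffZero_iff.2 fun _ i hi => ?_⟩⟩
      obtain ⟨hij, hiS⟩ := Finset.mem_erase.1 hi
      obtain ⟨a, ha⟩ := hσ hne i hiS
      cases a using Fin.cases with
      | zero =>
        obtain ⟨φ, hφ⟩ := hne
        exact absurd ((ha φ hφ).symm.trans (hzero φ hφ)) hij
      | succ a => exact ⟨a, ha⟩
  · rintro ⟨⟨j, hj⟩, h | ⟨hzero, h⟩⟩ hne i hi
    · obtain ⟨a, ha⟩ := mem_coverOffZero_iff.1 h hne i hi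
      exact ⟨a.succ, ha⟩
    · rcases eq_or_ne i j with rfl | hij
      · exact ⟨0, hzero⟩
      · obtain ⟨a, ha⟩ := mem_coverOffZero_iff.1 h hne i (Finset.mem_erase.2 ⟨hij, hi⟩)
        exact ⟨a.succ, ha⟩

theorem sphereExtends_coverFaces {n k d : ℕ} (hk : 1 ≤ k) {S : Finset (Fin k)}
    (h : d + S.card ≤ n) : SphereExtends d (polyhedron (coverFaces n k S)) := by
  classical
  induction n generalizing d S with
  | zero =>
    obtain rfl : S = ∅ := Finset.card_eq_zero.1 (by omega)
    have he : polyhedron (coverFaces 0 k ∅) = stdSimplex ℝ (Fin 0 → Fin k) := by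
      simp [polyhedron, coverFaces]
    rw [he]
    exact (convex_stdSimplex ℝ _).sphereExtends ⟨_, single_mem_stdSimplex ℝ (Fin.elim0 : Fin 0 → Fin k)⟩ d
  | succ n ih =>
    rcases S.eq_empty_or_nonempty with rfl | hS
    · have he : polyhedron (coverFaces (n + 1) k ∅) = stdSimplex ℝ (Fin (n + 1) → Fin k) := by
        simp [polyhedron, coverFaces]
      rw [he]
      exact (convex_stdSimplex ℝ _).sphereExtends
        ⟨_, single_mem_stdSimplex ℝ fun _ => (⟨0, hk⟩ : Fin k)⟩ d
    · rw [coverFaces_succ hS]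
      have : Nonempty S := hS.coe_sort
      refine SphereExtends.iUnion (A := coverOffZero n k S) isLowerSet_coverOffZero
        (mem_coverOffZero_iff.2 fun h => absurd h (by simp)) (fun _ => isLowerSet_coverZeroAt)
        (fun _ => subset_union_left)
        (fun i j hij => coverZeroAt_inter_subset fun he => hij (Subtype.ext he)) ?_ ?_
      · rintro ⟨j, hj⟩ e he
        refine SphereExtends.coverZeroAt (ih ?_)
        have := Finset.card_erase_add_one hj
        dsimp only
        omega
      · intro e he
        exact SphereExtends.coverOffZero ⟨0, hk⟩ (ih (by omega))

/-! ### Transfer to `K_{n,k}` and to Euclidean balls. -/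

theorem isLowerSet_faces_or_empty {V : Type*} (K : AbstractSimplicialComplex V) :
    IsLowerSet {σ : Finset V | σ.Nonempty → σ ∈ K.faces} := fun _ _ h hσ hne =>
  (K.isRelLowerSet_faces (hσ (hne.mono h))).2 h hne

theorem realization_eq_polyhedron {V : Type*} [Fintype V] (K : AbstractSimplicialComplex V) :
    K.realization = polyhedron {σ | σ.Nonempty → σ ∈ K.faces} := by
  ext x
  constructor
  · rintro ⟨hx, σ, hσ, h⟩
    refine ⟨hx, isLowerSet_faces_or_empty K (fun v hv => ?_) fun _ => hσ⟩
    by_contra hvσ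
    exact mem_coordSupport.1 hv (h v hvσ)
  · rintro ⟨hx, h⟩
    exact ⟨hx, _, h (coordSupport_nonempty hx), fun v hv => by simpa using hv⟩

theorem sphereExtends_surjComplex {n k d : ℕ} (hk : 1 ≤ k) (h : d + k ≤ n) :
    SphereExtends d (surjComplex n k).realization := by
  classical
  rw [realization_eq_polyhedron]
  have hmem : ∀ σ : Finset (SurjVertex n k), σ ∈ (surjComplex n k).faces ↔
      σ.Nonempty ∧ ∀ i, ∃ a, ∀ φ ∈ σ, φ.1 a = i := by
    intro σ
    simp [surjComplex, Set.Nonempty]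
  -- A default value making `toSurj` total; no simplex of `coverFaces n k univ` contains a
  -- non-surjective map.
  let ψ : SurjVertex n k :=
    ⟨fun a => if h : a.1 < k then ⟨a.1, h⟩ else ⟨0, hk⟩, fun i => ⟨⟨i.1, by omega⟩, by simp⟩⟩
  let toSurj : (Fin n → Fin k) → SurjVertex n k := fun φ =>
    if h : Function.Surjective φ then ⟨φ, h⟩ else ψ
  have hto : ∀ φ : SurjVertex n k, toSurj φ.1 = φ := fun φ => dif_pos φ.2
  refine (sphereExtends_coverFaces hk (S := Finset.univ) (by simpa using h)).of_contiguous
    (isLowerSet_faces_or_empty _) isLowerSet_coverFaces Subtype.val toSurj ?_ ?_ ?_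
  · intro σ hσ hne i _
    obtain ⟨a, ha⟩ := ((hmem σ).1 (hσ (Finset.image_nonempty.1 hne))).2 i
    refine ⟨a, fun φ hφ => ?_⟩
    obtain ⟨φ, hφσ, rfl⟩ := Finset.mem_image.1 hφ
    exact ha φ hφσ
  · intro σ hσ hne
    refine (hmem _).2 ⟨hne, fun i => ?_⟩
    have hne' := Finset.image_nonempty.1 hne
    obtain ⟨a, ha⟩ := hσ hne' i (Finset.mem_univ i)
    refine ⟨a, fun φ hφ => ?_⟩
    obtain ⟨φ, hφσ, rfl⟩ := Finset.mem_image.1 hφ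
    have hsurj : Function.Surjective φ := fun i' => by
      obtain ⟨a', ha'⟩ := hσ hne' i' (Finset.mem_univ i')
      exact ⟨a', ha' φ hφσ⟩
    simp only [toSurj, dif_pos hsurj]
    exact ha φ hφσ
  · intro σ hσ
    have he : (σ.image Subtype.val).image toSurj = σ := by
      rw [Finset.image_image]
      exact (Finset.image_congr fun φ _ => hto φ).trans Finset.image_id
    rwa [he, Finset.union_idempotent]

/-- The Euclidean ball and sphere are homeomorphic to those of the sup norm. -/
theorem exists_homeomorph_euclidean_ball (d : ℕ) :
    ∃ h : EuclideanSpace ℝ (Fin d) ≃ₜ (Fin d → ℝ), h '' closedBall 0 1 = closedBall 0 1 ∧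
      h '' sphere 0 1 = sphere 0 1 := by
  let e := (EuclideanSpace.equiv (Fin d) ℝ).toHomeomorph
  have hconv : Convex ℝ (e '' closedBall 0 1) :=
    (convex_closedBall (0 : EuclideanSpace ℝ (Fin d)) 1).is_linear_image
      (EuclideanSpace.equiv (Fin d) ℝ).toLinearEquiv.isLinear
  have hcomp : IsCompact (e '' closedBall 0 1) := (isCompact_closedBall _ _).image e.continuous
  have hint : (interior (e '' closedBall 0 1)).Nonempty := by
    rw [← e.image_interior]
    exact ⟨e 0, mem_image_of_mem e (ball_subset_interior_closedBall (mem_ball_self one_pos))⟩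
  obtain ⟨h, -, h2, h3⟩ := exists_homeomorph_image_interior_closure_frontier_eq_unitBall
    hconv hint hcomp.isBounded
  rw [hcomp.isClosed.closure_eq, image_image] at h2
  rw [← e.image_frontier, frontier_closedBall _ one_ne_zero, image_image] at h3
  exact ⟨e.trans h, h2, h3⟩

theorem SphereExtends.exists_continuousMap {V : Type*} {d : ℕ} {A : Set (V → ℝ)}
    (hA : SphereExtends d A) (f : C(sphere (0 : EuclideanSpace ℝ (Fin d)) 1, A)) :
    ∃ F : C(closedBall (0 : EuclideanSpace ℝ (Fin d)) 1, A),
      ∀ x : sphere (0 : EuclideanSpace ℝ (Fin d)) 1,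
        F ⟨x.1, sphere_subset_closedBall x.2⟩ = f x := by
  classical
  obtain ⟨h, hball, hsphere⟩ := exists_homeomorph_euclidean_ball d
  have hsymm : ∀ y ∈ sphere (0 : Fin d → ℝ) 1, h.symm y ∈ sphere 0 1 := by
    intro y hy
    rw [← hsphere] at hy
    obtain ⟨x, hx, rfl⟩ := hy
    simpa using hx
  let g : (Fin d → ℝ) → V → ℝ := fun y =>
    if hy : h.symm y ∈ sphere 0 1 then (f ⟨h.symm y, hy⟩).1 else 0
  have hg : ∀ y (hy : y ∈ sphere (0 : Fin d → ℝ) 1), g y = (f ⟨h.symm y, hsymm y hy⟩).1 :=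
    fun y hy => dif_pos (hsymm y hy)
  have hgc : ContinuousOn g (sphere 0 1) := by
    rw [continuousOn_iff_continuous_domRestrict]
    have : (sphere 0 1).domRestrict g =
        fun y : sphere (0 : Fin d → ℝ) 1 => (f ⟨h.symm y.1, hsymm y.1 y.2⟩).1 :=
      funext fun y => hg y.1 y.2
    rw [this]
    exact continuous_subtype_val.comp (f.continuous.comp
      ((h.symm.continuous.comp continuous_subtype_val).subtype_mk _))
  obtain ⟨F, h1, h2, h3⟩ := hA g hgc fun y hy => by
    rw [hg y hy]
    exact Subtype.prop _
  have hmem : ∀ x ∈ closedBall (0 : EuclideanSpace ℝ (Fin d)) 1, h x ∈ closedBall 0 1 :=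
    fun x hx => hball ▸ mem_image_of_mem h hx
  refine ⟨⟨fun x => ⟨F (h x.1), h2 (hmem x.1 x.2)⟩, Continuous.subtype_mk ?_ _⟩, fun x => ?_⟩
  · exact h1.comp_continuous (h.continuous.comp continuous_subtype_val) fun x => hmem x.1 x.2
  · have hx : h x.1 ∈ sphere (0 : Fin d → ℝ) 1 := hsphere ▸ mem_image_of_mem h x.2
    refine Subtype.ext ?_
    change F (h x.1) = _
    rw [h3 hx, hg _ hx]
    congr 2
    exact Subtype.ext (h.symm_apply_apply x.1)

end CoveringComplex

theorem lemma3 (n k : ℕ) (hk : 1 ≤ k) (hkn : k < n) :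
    IsMConnected ((n : ℤ) - (k : ℤ) - 1) (surjComplex n k).realization := by
  intro d hd f
  exact (sphereExtends_surjComplex hk (by omega)).exists_continuousMap f
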